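/- Let $\mathcal E$ be a separable complex Hilbert space and let $m$ be the normalized Lebesgue measure on the unit circle $\mathbb T$. Let $H^2_{\mathcal E}(\mathbb D)$ be the space of all $\mathcal E$-valued analytic functions $f(z)=\sum_{n\ge 0}a_nz^n$ on the open unit disc $\mathbb D$, with $a_n\in\mathcal E$ and $\sum_{n\ge 0}\|a_n\|^2<\infty$. (1) If $f\in H^2_{\mathcal E}(\mathbb D)$ is not identically zero on $\mathbb D$, then for $m$-almost every $z\in\mathbb T$ the radial limit $f(z):=\lim_{r\to 1^-}f(rz)$ exists in the norm of $\mathcal E$, and $$m\big(\{z\in\mathbb T: f(z)=0\}\big)=0 ,$$ where the set consists of the $z\in\mathbb T$ at which the radial limit exists and equals $0$. (2) The same holds for the Hardy space regarded as a subspace of $L^2_{\mathcal E}(\mathbb T)$: if $g\in L^2_{\mathcal E}(\mathbb T)$ is non-zero and its Fourier coefficients $\hat g(n)=\int_{\mathbb T}z^{-n}g(z)\,dm(z)$ vanish for all $n<0$, then $m(\{z\in\mathbb T: g(z)=0\})=0$. -/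

import Mathlib

open scoped Topology Real

instance factTwoPiPos : Fact (0 < 2 * π) := ⟨Real.two_pi_pos⟩

/-- A function `f` belongs to the `E`-valued Hardy space `H²_E(𝔻)`: on the open unit disc it is
the sum of a power series `∑ aₙ zⁿ` with coefficients `aₙ ∈ E` such that `∑ ‖aₙ‖² < ∞`.
Only the values of `f` on the open unit disc matter. -/
def MemHardyDisc {E : Type*} [NormedAddCommGroup E] [InnerProductSpace ℂ E] (f : ℂ → E) : Prop :=
  ∃ a : ℕ → E, Summable (fun n => ‖a n‖ ^ 2) ∧
    ∀ z ∈ Metric.ball (0 : ℂ) 1, HasSum (fun n => z ^ n • a n) (f z)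

/-- The normalized Lebesgue measure `m` on the unit circle `𝕋`. The circle is parametrized by
`AddCircle (2 * π)`, where `t` stands for the point `AddCircle.toCircle t = exp (i t)`. -/
noncomputable abbrev circleMeasure : MeasureTheory.Measure (AddCircle (2 * π)) :=
  AddCircle.haarAddCircle

/-- `f` has the radial limit `w` at the point `exp (i t)` of the unit circle:
`f (r exp (i t)) → w` as `r → 1`, `r < 1`. -/
def HasRadialLimit {E : Type*} [NormedAddCommGroup E] (f : ℂ → E) (t : AddCircle (2 * π))
    (w : E) : Prop :=
  Filter.Tendsto (fun r : ℝ => f ((r : ℂ) * (AddCircle.toCircle t : ℂ))) (𝓝[<] 1) (𝓝 w)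

/-- An element of `L²_E(𝕋)` belongs to the Hardy space, viewed as a subspace of `L²_E(𝕋)`: its
Fourier coefficients of negative index vanish. -/
def MemHardyCircle {E : Type*} [NormedAddCommGroup E] [InnerProductSpace ℂ E]
    (g : MeasureTheory.Lp E 2 circleMeasure) : Prop :=
  ∀ n : ℤ, n < 0 → fourierCoeff (g : AddCircle (2 * π) → E) n = 0

/-!
The boundary values of an `H²` function come from Fatou's theorem and their uniqueness from
Jensen's formula.

*Radial limits.* A square summable sequence `a` in `E` is, by the Riesz–Fischer theorem in `L²_E`
(`exists_Lp_fourierCoeff_eq`), the sequence of Fourier coefficients of some `g ∈ L²_E(𝕋)` whose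
coefficients of negative index vanish. The Poisson integral of such a `g` is the power series `∑
aₙ zⁿ` (`MeasureTheory.Integrable.hasSum_poissonKernel_smul`). At a Lebesgue point `t` of `g` the
Poisson integral tends radially to `g t` in norm (`ae_tendsto_integral_poissonKernel_smul`): with
`δ = 1 - r`, the Poisson kernel is dominated by a multiple of `δ / (δ² + d²)`, `d` being the
distance to `t`, and the layer cake formula bounds the integral of this kernel against `‖g - g t‖`
by the averages of `‖g - g t‖` over balls around `t` (`integral_cauchyKernel_mul_le`). Almost
every `t` is a Lebesgue point.

*Uniqueness.* Pairing `f` with one of its nonzero values reduces the claim to scalar functions.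
For a scalar `f ≠ 0` in `H²`, Jensen's formula bounds the mean of `log |f|` over the circle of
radius `r` below as `r → 1` (`exists_le_circleAverage_log_norm`), while the mean of `|f|²` is
bounded above. So the nonnegative functions `|f|² - log |f|` have bounded means, and by Fatou's
lemma their lower limit is finite almost everywhere
(`measure_radialLimit_zero_of_integral_bound`). It is infinite wherever the radial limit is `0`.

*Functions on the circle.* For `g ∈ L²_E(𝕋)` with vanishing coefficients of negative index, the
power series with coefficients `ĝ(n)` has radial limits `g` almost everywhere, so it is nonzero if
`g` is, and the zero set of `g` is, up to a null set, contained in the set where the radial limit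
is `0`.
-/

open Filter MeasureTheory Metric Set Real

/-! ### Jensen's formula and uniqueness of radial limits -/

/-- The averages of `log ‖f‖` over the circles of radius `r ∈ [1/2, 1)` are bounded below. By
Jensen's formula such an average is a nonnegative contribution of the zeros away from the centre,
plus `d * log r`, where `d` is the order of vanishing at the centre, plus a constant. -/
theorem exists_le_circleAverage_log_norm {f : ℂ → ℂ} (hf : AnalyticOnNhd ℂ f (ball 0 1))
    (hne : ∃ z ∈ ball (0 : ℂ) 1, f z ≠ 0) :
    ∃ C : ℝ, ∀ r ∈ Ico (1 / 2 : ℝ) 1, C ≤ circleAverage (log ‖f ·‖) 0 r := by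
  obtain ⟨z, hz, hfz⟩ := hne
  -- The order of vanishing at the centre, written as it occurs in Jensen's formula.
  set d : ℤ := (ENat.map Nat.cast (analyticOrderAt f 0)).untop₀ with hd
  have hd0 : (0 : ℝ) ≤ d := by
    cases h : analyticOrderAt f 0 <;> simp [hd, h]
  refine ⟨d * log (1 / 2) + log ‖meromorphicTrailingCoeffAt f 0‖,
    fun r hr ↦ ?_⟩
  have hr0 : 0 < r := by linarith [hr.1]
  have hsub : closedBall (0 : ℂ) |r| ⊆ ball 0 1 := by
    rw [abs_of_pos hr0]; exact closedBall_subset_ball hr.2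
  have hfr := hf.mono hsub
  rw [hfr.meromorphicOn.circleAverage_log_norm hr0.ne',
    MeromorphicOn.AnalyticOnNhd.divisor_apply hfr (by simp)]
  have h1 : 0 ≤ ∑ᶠ u, (MeromorphicOn.divisor f (closedBall 0 |r|) u : ℝ) *
      log (r * ‖(0 : ℂ) - u‖⁻¹) := by
    refine finsum_nonneg fun u ↦ ?_
    by_cases hu : u ∈ closedBall (0 : ℂ) |r|
    · refine mul_nonneg (mod_cast MeromorphicOn.AnalyticOnNhd.divisor_nonneg hfr _) ?_
      rcases eq_or_ne u 0 with rfl | hu0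
      · simp
      · apply log_nonneg
        have : ‖u‖ ≤ r := by simpa [abs_of_pos hr0] using hu
        have hu' : 0 < ‖u‖ := norm_pos_iff.2 hu0
        rw [zero_sub, norm_neg, ← div_eq_mul_inv, one_le_div hu']
        exact this
    · simp [hu]
  have h2 : log (1 / 2) ≤ log r := log_le_log (by norm_num) hr.1
  have h3 : (d : ℝ) * log (1 / 2) ≤ d * log r := by gcongr
  linarith

theorem circleMap_eq_mul_toCircle (r θ : ℝ) :
    circleMap 0 r θ = r * (AddCircle.toCircle (θ : AddCircle (2 * π)) : ℂ) := by
  have : (2 * π) / (2 * π) * θ = θ := by field_simp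
  rw [circleMap, zero_add, AddCircle.toCircle_apply_mk, this, Circle.coe_exp]

theorem circleAverage_eq_integral_circleMeasure {F : Type*} [NormedAddCommGroup F]
    [NormedSpace ℝ F] (u : ℂ → F) (r : ℝ) :
    circleAverage u 0 r = ∫ t, u (r * (AddCircle.toCircle t : ℂ)) ∂circleMeasure := by
  rw [AddCircle.integral_haarAddCircle, circleAverage_def,
    ← AddCircle.intervalIntegral_preimage (2 * π) 0, zero_add]
  simp_rw [circleMap_eq_mul_toCircle]

theorem integrable_circleMeasure_of_circleIntegrable {F : Type*} [NormedAddCommGroup F]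
    {u : ℂ → F} {r : ℝ} (hu : CircleIntegrable u 0 r)
    (hm : AEStronglyMeasurable (fun t ↦ u (r * (AddCircle.toCircle t : ℂ))) circleMeasure) :
    Integrable (fun t ↦ u (r * (AddCircle.toCircle t : ℂ))) circleMeasure := by
  have hv : (volume : Measure (AddCircle (2 * π))) = ENNReal.ofReal (2 * π) • circleMeasure :=
    AddCircle.volume_eq_smul_haarAddCircle
  have h2 : ENNReal.ofReal (2 * π) ≠ 0 := by simp [Real.pi_pos]
  rw [← integrable_smul_measure h2 ENNReal.ofReal_ne_top, ← hv,
    ← (AddCircle.measurePreserving_mk (2 * π) 0).integrable_comp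
      (by rw [hv]; exact hm.smul_measure _)]
  rw [zero_add]
  have := hu.1
  simpa only [IntegrableOn, Function.comp_def, circleMap_eq_mul_toCircle] using this

theorem circleMeasure_of_countable {s : Set (AddCircle (2 * π))} (hs : s.Countable) :
    circleMeasure s = 0 := by
  have hsing (t : AddCircle (2 * π)) : circleMeasure {t} = 0 := by
    have h := AddCircle.volume_closedBall (2 * π) (x := t) 0
    -- A point is a closed ball of radius `0`.
    rw [closedBall_zero, AddCircle.volume_eq_smul_haarAddCircle, mul_zero,
      min_eq_right Real.two_pi_pos.le] at h
    simpa [Real.pi_pos.not_ge] using h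
  rw [← biUnion_of_singleton s, measure_biUnion_null_iff hs]
  exact fun t _ ↦ hsing t

theorem ae_ne_zero_on_circle {f : ℂ → ℂ} (hf : AnalyticOnNhd ℂ f (ball 0 1))
    (hne : ∃ z ∈ ball (0 : ℂ) 1, f z ≠ 0) {r : ℝ} (hr : r ∈ Ioo (0 : ℝ) 1) :
    ∀ᵐ t ∂circleMeasure, f (r * (AddCircle.toCircle t : ℂ)) ≠ 0 := by
  obtain ⟨z, hz, hfz⟩ := hne
  have hcod := hf.preimage_zero_mem_codiscreteWithin hfz hz
    ⟨⟨z, hz⟩, (convex_ball _ _).isPreconnected⟩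
  have hsub : sphere (0 : ℂ) r ⊆ ball 0 1 := fun w hw ↦ by
    have := hr.2
    simp_all
  have hcod' := codiscreteWithin_mono hsub hcod
  have hcount : (sphere (0 : ℂ) r \ f ⁻¹' {0}ᶜ).Countable :=
    ((isCompact_sphere (0 : ℂ) r).finite_sdiff_of_mem_codiscreteWithin hcod').countable
  have hinj : Function.Injective
      (fun t : AddCircle (2 * π) ↦ (r : ℂ) * (AddCircle.toCircle t : ℂ)) := by
    intro a b hab
    have h0 : (r : ℂ) ≠ 0 := by exact_mod_cast hr.1.ne'
    exact AddCircle.injective_toCircle Real.two_pi_pos.ne' (Circle.ext (mul_left_cancel₀ h0 hab))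
  have hnull := circleMeasure_of_countable (hcount.preimage hinj)
  rw [ae_iff]
  refine measure_mono_null (fun t ht ↦ ?_) hnull
  simp only [mem_ofPred_eq, not_not] at ht
  refine ⟨?_, by simpa using ht⟩
  simp [abs_of_pos hr.1, Circle.norm_coe]

/-- Uniqueness for analytic functions bounded in mean square on the circles `|z| = r`. The functions
`‖f‖ ^ 2 - log ‖f‖` are nonnegative, with integrals over these circles bounded as `r → 1`, and they
tend to `∞` wherever `f` has radial limit `0`; Fatou's lemma makes that set null. -/
theorem measure_radialLimit_zero_of_integral_bound {f : ℂ → ℂ}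
    (hf : AnalyticOnNhd ℂ f (ball 0 1)) (hne : ∃ z ∈ ball (0 : ℂ) 1, f z ≠ 0) {M : ℝ}
    (hM : ∀ r ∈ Ioo (0 : ℝ) 1, ∫ t, ‖f (r * (AddCircle.toCircle t : ℂ))‖ ^ 2 ∂circleMeasure ≤ M) :
    circleMeasure {t | HasRadialLimit f t 0} = 0 := by
  obtain ⟨C, hC⟩ := exists_le_circleAverage_log_norm hf hne
  set r : ℕ → ℝ := fun k ↦ 1 - 1 / 2 * (1 / ((k : ℝ) + 1)) with hr
  have hr_mem (k : ℕ) : r k ∈ Ico (1 / 2 : ℝ) 1 := by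
    have h1 : 0 < 1 / ((k : ℝ) + 1) := by positivity
    have h2 : 1 / ((k : ℝ) + 1) ≤ 1 := by
      rw [div_le_one (by positivity)]; linarith [Nat.cast_nonneg (α := ℝ) k]
    constructor <;> simp only [hr] <;> linarith
  have hr_mem' (k : ℕ) : r k ∈ Ioo (0 : ℝ) 1 := ⟨by linarith [(hr_mem k).1], (hr_mem k).2⟩
  have hr_lim : Tendsto r atTop (𝓝[<] 1) := by
    refine tendsto_nhdsWithin_iff.2 ⟨?_, Eventually.of_forall fun k ↦ (hr_mem k).2⟩
    have h := (tendsto_one_div_add_atTop_nhds_zero_nat (𝕜 := ℝ)).const_mul (1 / 2)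
    simpa only [hr, mul_zero, sub_zero] using h.const_sub 1
  have hcont (k : ℕ) : Continuous fun t : AddCircle (2 * π) ↦
      f (r k * (AddCircle.toCircle t : ℂ)) := by
    refine hf.continuousOn.comp_continuous ?_ fun t ↦ ?_
    · exact continuous_const.mul (continuous_subtype_val.comp AddCircle.continuous_toCircle)
    · simpa [abs_of_pos (hr_mem' k).1, Circle.norm_coe] using (hr_mem k).2
  -- `log x ≤ x ^ 2` makes `v k` nonnegative, also at the zeros of `f`, where `log 0 = 0`.
  set v : ℕ → AddCircle (2 * π) → ℝ := fun k t ↦ ‖f (r k * (AddCircle.toCircle t : ℂ))‖ ^ 2 -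
    log ‖f (r k * (AddCircle.toCircle t : ℂ))‖ with hv
  have hv_nonneg (k : ℕ) (t) : 0 ≤ v k t := by
    have h0 := norm_nonneg (f (r k * (AddCircle.toCircle t : ℂ)))
    rcases h0.eq_or_lt with h | h
    · simp [hv, ← h]
    · have := log_le_sub_one_of_pos h
      simp only [hv]
      nlinarith [sq_nonneg (‖f (r k * (AddCircle.toCircle t : ℂ))‖ - 1)]
  have hv_meas (k : ℕ) : Measurable (v k) :=
    ((hcont k).norm.pow 2).measurable.sub (Real.measurable_log.comp (hcont k).norm.measurable)
  have hi1 (k : ℕ) : Integrable (fun t ↦ ‖f (r k * (AddCircle.toCircle t : ℂ))‖ ^ 2)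
      circleMeasure := ((hcont k).norm.pow 2).integrable_of_hasCompactSupport
        (HasCompactSupport.of_compactSpace _)
  have hi2 (k : ℕ) : Integrable (fun t ↦ log ‖f (r k * (AddCircle.toCircle t : ℂ))‖)
      circleMeasure := by
    refine integrable_circleMeasure_of_circleIntegrable (u := fun z ↦ log ‖f z‖)
      (MeromorphicOn.circleIntegrable_log_norm fun w hw ↦ (hf w ?_).meromorphicAt)
      (Real.measurable_log.comp (hcont k).norm.measurable).aestronglyMeasurable
    rw [mem_sphere_zero_iff_norm, abs_of_pos (hr_mem' k).1] at hw
    simpa [hw] using (hr_mem k).2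
  have hbound (k : ℕ) : ∫⁻ t, ENNReal.ofReal (v k t) ∂circleMeasure ≤ ENNReal.ofReal (M - C) := by
    rw [← ofReal_integral_eq_lintegral_ofReal (f := v k) ((hi1 k).sub (hi2 k))
      (Eventually.of_forall (hv_nonneg k))]
    apply ENNReal.ofReal_le_ofReal
    rw [integral_sub (hi1 k) (hi2 k)]
    have h1 := hM _ (hr_mem' k)
    have h2 := hC _ (hr_mem k)
    rw [circleAverage_eq_integral_circleMeasure] at h2
    linarith
  have hfatou : ∫⁻ t, liminf (fun k ↦ ENNReal.ofReal (v k t)) atTop ∂circleMeasure ≠ ⊤ := by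
    refine ne_top_of_le_ne_top (ENNReal.ofReal_ne_top (r := M - C)) ((lintegral_liminf_le
      fun k ↦ (hv_meas k).ennreal_ofReal).trans ?_)
    refine (liminf_le_liminf (Eventually.of_forall hbound)).trans_eq (liminf_const _)
  have hfin := ae_lt_top (.liminf fun k ↦ (hv_meas k).ennreal_ofReal) hfatou
  have hnz := ae_all_iff.2 fun k ↦ ae_ne_zero_on_circle hf hne (hr_mem' k)
  have : ∀ᵐ t ∂circleMeasure, ¬ HasRadialLimit f t 0 := by
    filter_upwards [hfin, hnz] with t ht hnzt hlim
    refine ht.ne ?_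
    have h0 : Tendsto (fun k ↦ ‖f (r k * (AddCircle.toCircle t : ℂ))‖) atTop (𝓝 0) := by
      simpa using (hlim.comp hr_lim).norm
    have h1 : Tendsto (fun k ↦ v k t) atTop atTop := by
      have hlog := Real.tendsto_log_nhdsNE_zero.comp (tendsto_nhdsWithin_iff.2
        ⟨h0, Eventually.of_forall fun k ↦ norm_ne_zero_iff.2 (hnzt k)⟩)
      exact (h0.pow 2).add_atTop (tendsto_neg_atBot_atTop.comp hlog)
    exact (ENNReal.tendsto_ofReal_atTop.comp h1).liminf_eq
  rw [ae_iff] at this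
  simpa using this

/-! ### Uniqueness in the Hardy space of the disc -/

theorem summable_pow_mul_of_summable_sq {a : ℕ → ℝ} (ha : Summable fun n ↦ a n ^ 2) {r : ℝ}
    (hr : r ∈ Ico (0 : ℝ) 1) (ha0 : ∀ n, 0 ≤ a n) : Summable fun n ↦ r ^ n * a n := by
  have hs := (summable_geometric_of_lt_one (sq_nonneg r) (by nlinarith [hr.1, hr.2])).add ha
  refine hs.of_nonneg_of_le (fun n ↦ mul_nonneg (pow_nonneg hr.1 n) (ha0 n)) fun n ↦ ?_
  -- Young's inequality, with `(r ^ n) ^ 2 = (r ^ 2) ^ n`.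
  rw [← pow_mul, mul_comm 2 n, pow_mul]
  nlinarith [sq_nonneg (r ^ n - a n), sq_nonneg (r ^ n), sq_nonneg (a n)]

theorem MemHardyDisc.analyticOnNhd {f : ℂ → ℂ} (hf : MemHardyDisc f) :
    AnalyticOnNhd ℂ f (ball 0 1) := by
  obtain ⟨b, hb, hfb⟩ := hf
  obtain ⟨C, hC⟩ := hb.tendsto_atTop_zero.bddAbove_range
  have hC' (n : ℕ) : ‖b n‖ ≤ C + 1 := by
    have : ‖b n‖ ^ 2 ≤ C := hC ⟨n, rfl⟩
    nlinarith [sq_nonneg (‖b n‖ - 1)]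
  have hps : HasFPowerSeriesOnBall f (FormalMultilinearSeries.ofScalars ℂ b) 0 1 := by
    refine ⟨?_, one_pos, fun {y} hy ↦ ?_⟩
    · refine FormalMultilinearSeries.le_radius_of_bound (r := 1) _ (C + 1) fun n ↦ ?_
      simpa [FormalMultilinearSeries.ofScalars_norm] using hC' n
    · have hy' : y ∈ ball (0 : ℂ) 1 := by
        simpa only [← ENNReal.ofReal_one, eball_ofReal] using hy
      simpa [FormalMultilinearSeries.ofScalars_apply_eq, mul_comm] using hfb y hy'
  have := hps.analyticOnNhd
  intro z hz
  exact this z (by simpa only [← ENNReal.ofReal_one, eball_ofReal] using hz)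

theorem pow_mul_toCircle (r : ℝ) (t : AddCircle (2 * π)) (n : ℕ) :
    ((r : ℂ) * (AddCircle.toCircle t : ℂ)) ^ n = (r : ℂ) ^ n * fourier (n : ℤ) t := by
  rw [mul_pow, fourier_apply, natCast_zsmul, AddCircle.toCircle_nsmul, Circle.coe_pow]

theorem mul_toCircle_mem_ball {r : ℝ} (hr : r ∈ Ioo (0 : ℝ) 1) (t : AddCircle (2 * π)) :
    (r : ℂ) * (AddCircle.toCircle t : ℂ) ∈ ball (0 : ℂ) 1 := by
  simpa [abs_of_pos hr.1, Circle.norm_coe] using hr.2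

/-- The square means of an `H²` function over the circles of radius `r < 1` are bounded by the
`H²` norm. -/
theorem integral_norm_sq_le_tsum {f : ℂ → ℂ} {b : ℕ → ℂ} (hb : Summable fun n ↦ ‖b n‖ ^ 2)
    (hfb : ∀ z ∈ ball (0 : ℂ) 1, HasSum (fun n ↦ z ^ n • b n) (f z)) {r : ℝ}
    (hr : r ∈ Ioo (0 : ℝ) 1) :
    ∫ t, ‖f (r * (AddCircle.toCircle t : ℂ))‖ ^ 2 ∂circleMeasure ≤ ∑' n, ‖b n‖ ^ 2 := by
  set c : ℕ → ℂ := fun n ↦ r ^ n * b n with hc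
  have hsum : Summable fun n : ℕ ↦ c n • (fourier (n : ℤ) : C(AddCircle (2 * π), ℂ)) := by
    refine Summable.of_norm ?_
    simpa [norm_smul, fourier_norm, hc, abs_of_pos hr.1] using
      summable_pow_mul_of_summable_sq hb (Ioo_subset_Ico_self hr) fun n ↦ norm_nonneg _
  set F := ∑' n : ℕ, c n • (fourier (n : ℤ) : C(AddCircle (2 * π), ℂ))
  have hF (t) : F t = f (r * (AddCircle.toCircle t : ℂ)) := by
    have h1 := (ContinuousMap.evalCLM ℂ t).hasSum hsum.hasSum
    refine h1.unique ?_
    convert! hfb _ (mul_toCircle_mem_ball hr t) using 2 with n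
    rw [pow_mul_toCircle]
    simp only [hc, ContinuousMap.evalCLM_apply, ContinuousMap.smul_apply, smul_eq_mul]
    ring
  have hL : HasSum (fun n : ℕ ↦ c n • fourierLp 2 (n : ℤ))
      (ContinuousMap.toLp (E := ℂ) 2 circleMeasure ℂ F) := by
    simpa [fourierLp] using (ContinuousMap.toLp (E := ℂ) 2 circleMeasure ℂ).hasSum hsum.hasSum
  have hnorm : ∫ t, ‖f (r * (AddCircle.toCircle t : ℂ))‖ ^ 2 ∂circleMeasure =
      ‖ContinuousMap.toLp (E := ℂ) 2 circleMeasure ℂ F‖ ^ 2 := by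
    have h := ContinuousMap.inner_toLp (𝕜 := ℂ) circleMeasure F F
    rw [inner_self_eq_norm_sq_to_K] at h
    have h2 (t : AddCircle (2 * π)) : F t * (starRingEnd ℂ) (F t) =
        ((‖f (r * (AddCircle.toCircle t : ℂ))‖ ^ 2 : ℝ) : ℂ) := by
      rw [hF, Complex.mul_conj, Complex.normSq_eq_norm_sq]
    have h3 : ∫ t, F t * (starRingEnd ℂ) (F t) ∂circleMeasure =
        ((∫ t, ‖f (r * (AddCircle.toCircle t : ℂ))‖ ^ 2 ∂circleMeasure : ℝ) : ℂ) := by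
      rw [← integral_complex_ofReal]
      exact integral_congr_ae (Eventually.of_forall h2)
    apply Complex.ofReal_injective
    rw [Complex.ofReal_pow]
    exact (h.trans h3).symm
  rw [hnorm]
  have ho : Orthonormal ℂ fun n : ℕ ↦ fourierLp (T := 2 * π) 2 (n : ℤ) :=
    orthonormal_fourier.comp _ Nat.cast_injective
  refine le_of_tendsto ((hL.norm.pow 2)) (Eventually.of_forall fun s ↦ ?_)
  have hs : ‖∑ n ∈ s, c n • fourierLp (T := 2 * π) 2 (n : ℤ)‖ ^ 2 = ∑ n ∈ s, ‖c n‖ ^ 2 := by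
    have h := ho.inner_sum c c s
    rw [inner_self_eq_norm_sq_to_K] at h
    simp_rw [← Complex.normSq_eq_conj_mul_self, Complex.normSq_eq_norm_sq] at h
    apply Complex.ofReal_injective
    rw [Complex.ofReal_pow, Complex.ofReal_sum]
    exact h
  rw [hs]
  refine (Finset.sum_le_sum fun n _ ↦ ?_).trans (hb.sum_le_tsum s fun n _ ↦ by positivity)
  rw [hc, norm_mul, norm_pow, Complex.norm_real, norm_of_nonneg hr.1.le]
  refine pow_le_pow_left₀ (by have := hr.1; positivity) ?_ 2
  exact mul_le_of_le_one_left (norm_nonneg _) (pow_le_one₀ hr.1.le hr.2.le)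

theorem MemHardyDisc.measure_radialLimit_zero_scalar {f : ℂ → ℂ} (hf : MemHardyDisc f)
    (hne : ∃ z ∈ ball (0 : ℂ) 1, f z ≠ 0) : circleMeasure {t | HasRadialLimit f t 0} = 0 := by
  have ha := hf.analyticOnNhd
  obtain ⟨b, hb, hfb⟩ := hf
  exact measure_radialLimit_zero_of_integral_bound ha hne fun r hr ↦
    integral_norm_sq_le_tsum hb hfb hr

/-- A vector-valued `f` with `f z ≠ 0` is reduced to the scalar function `w ↦ ⟪f z, f w⟫`, which
does not vanish at `z` and has radial limit `0` wherever `f` has. -/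
theorem MemHardyDisc.measure_radialLimit_zero {E : Type*} [NormedAddCommGroup E]
    [InnerProductSpace ℂ E] {f : ℂ → E} (hf : MemHardyDisc f)
    (hne : ∃ z ∈ ball (0 : ℂ) 1, f z ≠ 0) : circleMeasure {t | HasRadialLimit f t 0} = 0 := by
  obtain ⟨a, ha, hfa⟩ := hf
  obtain ⟨z, hz, hfz⟩ := hne
  have hh : MemHardyDisc fun w ↦ inner ℂ (f z) (f w) := by
    refine ⟨fun n ↦ inner ℂ (f z) (a n), (ha.mul_left (‖f z‖ ^ 2)).of_nonneg_of_le
      (fun n ↦ by positivity) fun n ↦ ?_, fun w hw ↦ ?_⟩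
    · rw [← mul_pow]
      gcongr
      exact norm_inner_le_norm _ _
    · simpa [inner_smul_right] using (innerSL ℂ (f z)).hasSum (hfa w hw)
  refine measure_mono_null (fun t ht ↦ ?_)
    (hh.measure_radialLimit_zero_scalar ⟨z, hz, inner_self_ne_zero.2 hfz⟩)
  have h := ((innerSL ℂ (f z)).continuous.tendsto 0).comp ht
  rwa [map_zero] at h

/-! ### Fatou's theorem: radial limits of Poisson integrals -/

theorem lintegral_sqrt_div {δ : ℝ} (hδ : 0 < δ) {ε : ℝ} (hε : 0 ≤ ε) :
    ∫⁻ l in Ioc 0 (1 / δ), ENNReal.ofReal (ε * √(δ / l)) = ENNReal.ofReal (2 * ε) := by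
  have hint : IntegrableOn (fun l : ℝ ↦ l ^ (-(1 / 2) : ℝ)) (Ioc 0 (1 / δ)) := by
    rw [← intervalIntegrable_iff_integrableOn_Ioc_of_le (by positivity)]
    exact intervalIntegral.intervalIntegrable_rpow' (by norm_num)
  have hval : ∫ l in Ioc 0 (1 / δ), l ^ (-(1 / 2) : ℝ) = 2 / √δ := by
    rw [← intervalIntegral.integral_of_le (by positivity), integral_rpow (by norm_num)]
    norm_num
    rw [← Real.sqrt_eq_rpow, Real.sqrt_inv]
    ring
  have hcongr : ∀ l ∈ Ioc 0 (1 / δ), ENNReal.ofReal (ε * √(δ / l)) =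
      ENNReal.ofReal (ε * √δ * l ^ (-(1 / 2) : ℝ)) := fun l hl ↦ by
    rw [Real.rpow_neg hl.1.le, ← Real.sqrt_eq_rpow, Real.sqrt_div hδ.le]
    ring_nf
  rw [setLIntegral_congr_fun measurableSet_Ioc hcongr,
    ← ofReal_integral_eq_lintegral_ofReal (hint.const_mul _)]
  · rw [integral_const_mul, hval]
    congr 1
    have : √δ ≠ 0 := (Real.sqrt_pos.2 hδ).ne'
    field_simp
  · filter_upwards [ae_restrict_mem measurableSet_Ioc] with l hl
    have := hl.1
    positivity

/-- A measure with `μ (closedBall x ρ) ≤ ε ρ` for small `ρ` has an integral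
`∫ δ / (δ² + d(y, x)²) dμ(y)` of size `O(ε)` as `δ → 0`. By the layer cake formula the integral is
`∫ μ {y | l ≤ δ / (δ² + d(y, x)²)} dl`; the superlevel set is empty for `l > 1 / δ`, and it lies in
the ball of radius `√(δ / l)`, which is at most `η` once `l ≥ δ / η²`. -/
theorem lintegral_cauchyKernel_le {X : Type*} [PseudoMetricSpace X] [MeasurableSpace X]
    [OpensMeasurableSpace X] (μ : Measure X) (x : X) {δ ε η : ℝ} (hδ : 0 < δ) (hε : 0 ≤ ε)
    (hη : 0 < η)
    (h : ∀ ρ ∈ Ioc 0 η, μ (closedBall x ρ) ≤ ENNReal.ofReal (ε * ρ)) :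
    ∫⁻ y, ENNReal.ofReal (δ / (δ ^ 2 + dist y x ^ 2)) ∂μ ≤
      ENNReal.ofReal (2 * ε) + μ univ * ENNReal.ofReal (δ / η ^ 2) := by
  have hcont : Continuous fun y ↦ δ / (δ ^ 2 + dist y x ^ 2) :=
    continuous_const.div (by fun_prop) fun y ↦ by positivity
  rw [lintegral_eq_lintegral_meas_le μ (Eventually.of_forall fun y ↦ by positivity)
    hcont.measurable.aemeasurable]
  have hle : ∀ l ∈ Ioi (0 : ℝ), μ {y | l ≤ δ / (δ ^ 2 + dist y x ^ 2)} ≤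
      (Ioc 0 (1 / δ)).indicator (fun l ↦ ENNReal.ofReal (ε * √(δ / l))) l +
      (Ioc 0 (δ / η ^ 2)).indicator (fun _ ↦ μ univ) l := by
    intro l hl
    have hl : 0 < l := hl
    by_cases h1 : l ≤ δ / η ^ 2
    · rw [indicator_of_mem (show l ∈ Ioc 0 (δ / η ^ 2) from ⟨hl, h1⟩)]
      exact le_add_left (measure_mono (subset_univ _))
    have hsub : {y | l ≤ δ / (δ ^ 2 + dist y x ^ 2)} ⊆ closedBall x √(δ / l) := by
      intro y hy
      have hy : l ≤ δ / (δ ^ 2 + dist y x ^ 2) := hy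
      rw [le_div_comm₀ hl (by positivity)] at hy
      exact Real.le_sqrt_of_sq_le (by nlinarith [sq_nonneg δ])
    by_cases h2 : l ≤ 1 / δ
    · rw [indicator_of_mem (show l ∈ Ioc 0 (1 / δ) from ⟨hl, h2⟩)]
      refine le_add_right ((measure_mono hsub).trans (h _ ⟨by positivity, ?_⟩))
      rw [Real.sqrt_le_left hη.le, div_le_comm₀ hl (by positivity)]
      exact (not_le.1 h1).le
    · have : {y | l ≤ δ / (δ ^ 2 + dist y x ^ 2)} = ∅ := by
        refine eq_empty_of_forall_notMem fun y hy ↦ h2 ?_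
        have hy : l ≤ δ / (δ ^ 2 + dist y x ^ 2) := hy
        rw [le_div_iff₀ (by positivity)] at hy
        rw [le_div_iff₀ hδ]
        have : l * δ ^ 2 ≤ δ := by nlinarith [mul_nonneg hl.le (sq_nonneg (dist y x))]
        nlinarith
      simp [this]
  refine (setLIntegral_mono' measurableSet_Ioi hle).trans ?_
  rw [lintegral_add_left' ?_]
  · gcongr
    · rw [← lintegral_sqrt_div hδ hε, ← lintegral_indicator measurableSet_Ioc]
      exact setLIntegral_le_lintegral _ _
    · refine (setLIntegral_le_lintegral _ _).trans ?_
      rw [lintegral_indicator measurableSet_Ioc, setLIntegral_const]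
      simp
  · refine AEMeasurable.indicator ?_ measurableSet_Ioc
    fun_prop

theorem integral_cauchyKernel_mul_le {X : Type*} [PseudoMetricSpace X] [MeasurableSpace X]
    [OpensMeasurableSpace X] {ν : Measure X} {φ : X → ℝ} (hφ : Integrable φ ν) (hφ0 : 0 ≤ φ)
    (x : X) {δ ε η : ℝ} (hδ : 0 < δ) (hε : 0 ≤ ε) (hη : 0 < η)
    (h : ∀ ρ ∈ Ioc 0 η, ∫ y in closedBall x ρ, φ y ∂ν ≤ ε * ρ) :
    ∫ y, δ / (δ ^ 2 + dist y x ^ 2) * φ y ∂ν ≤ 2 * ε + (∫ y, φ y ∂ν) * (δ / η ^ 2) := by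
  have hcont : Continuous fun y ↦ δ / (δ ^ 2 + dist y x ^ 2) :=
    continuous_const.div (by fun_prop) fun y ↦ by positivity
  have hφm : AEMeasurable (fun y ↦ ENNReal.ofReal (φ y)) ν := hφ.1.aemeasurable.ennreal_ofReal
  have key := lintegral_cauchyKernel_le (ν.withDensity fun y ↦ ENNReal.ofReal (φ y)) x hδ hε hη
    fun ρ hρ ↦ by
      rw [withDensity_apply _ measurableSet_closedBall,
        ← ofReal_integral_eq_lintegral_ofReal hφ.integrableOn (Eventually.of_forall hφ0)]
      exact ENNReal.ofReal_le_ofReal (h ρ hρ)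
  rw [withDensity_apply _ MeasurableSet.univ, Measure.restrict_univ,
    ← ofReal_integral_eq_lintegral_ofReal hφ (Eventually.of_forall hφ0),
    lintegral_withDensity_eq_lintegral_mul₀ hφm
      hcont.measurable.aemeasurable.ennreal_ofReal,
    ← ENNReal.ofReal_mul (integral_nonneg hφ0), ← ENNReal.ofReal_add (by positivity)
      (mul_nonneg (integral_nonneg hφ0) (by positivity))] at key
  rw [integral_eq_lintegral_of_nonneg_ae
    (Eventually.of_forall fun y ↦ mul_nonneg (by positivity) (hφ0 y))
    (hcont.aestronglyMeasurable.mul hφ.1)]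
  refine ENNReal.toReal_le_of_le_ofReal (add_nonneg (by positivity)
    (mul_nonneg (integral_nonneg hφ0) (by positivity))) (le_trans (le_of_eq ?_) key)
  refine lintegral_congr fun y ↦ ?_
  rw [Pi.mul_apply, mul_comm, ENNReal.ofReal_mul (hφ0 y)]

/-- The chord is at least `2 / π` times the arc. -/
theorem two_div_pi_mul_dist_le_norm_sub_toCircle (s t : AddCircle (2 * π)) :
    2 / π * dist s t ≤ ‖(AddCircle.toCircle s : ℂ) - AddCircle.toCircle t‖ := by
  induction s using QuotientAddGroup.induction_on with | H x => ?_
  induction t using QuotientAddGroup.induction_on with | H y => ?_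
  have h := Complex.mul_angle_le_norm_sub (Complex.norm_exp_ofReal_mul_I x)
    (Complex.norm_exp_ofReal_mul_I y)
  rw [Complex.angle_exp_exp] at h
  have hx (x : ℝ) : (AddCircle.toCircle (x : AddCircle (2 * π)) : ℂ) =
      Complex.exp (x * Complex.I) := by
    have := circleMap_eq_mul_toCircle 1 x
    simpa [circleMap] using this.symm
  rw [hx, hx]
  refine le_trans ?_ h
  gcongr
  have hmod : ((toIocMod Real.two_pi_pos (-π) (x - y) : ℝ) : AddCircle (2 * π)) =
      ((x - y : ℝ) : AddCircle (2 * π)) := by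
    rw [toIocMod, QuotientAddGroup.mk_sub, QuotientAddGroup.mk_zsmul]
    simp [AddCircle.coe_period]
  rw [dist_eq_norm, ← QuotientAddGroup.mk_sub]
  exact (congrArg norm hmod).symm.trans_le QuotientAddGroup.norm_mk_le_norm

theorem poissonKernel_toCircle_le {r : ℝ} (hr : r ∈ Ico (1 / 2 : ℝ) 1) (s t : AddCircle (2 * π)) :
    poissonKernel 0 (r * (AddCircle.toCircle t : ℂ)) (AddCircle.toCircle s : ℂ) ≤
      π ^ 2 * ((1 - r) / ((1 - r) ^ 2 + dist s t ^ 2)) := by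
  have hr0 : 0 < r := by linarith [hr.1]
  have hδ : 0 < 1 - r := by linarith [hr.2]
  have hd := two_div_pi_mul_dist_le_norm_sub_toCircle s t
  -- For unit vectors `|z - r w|² = (1 - r)² + r |z - w|²`.
  have h1 : ‖(AddCircle.toCircle s : ℂ) - r * AddCircle.toCircle t‖ ^ 2 =
      (1 - r) ^ 2 + r * ‖(AddCircle.toCircle s : ℂ) - AddCircle.toCircle t‖ ^ 2 := by
    have hs := Circle.normSq_coe (AddCircle.toCircle s)
    have ht := Circle.normSq_coe (AddCircle.toCircle t)
    rw [Complex.normSq_apply] at hs ht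
    rw [← Complex.normSq_eq_norm_sq, ← Complex.normSq_eq_norm_sq, Complex.normSq_apply,
      Complex.normSq_apply]
    simp
    linear_combination (1 - r) * hs + (r ^ 2 - r) * ht
  have h2 : 2 / π ^ 2 * ((1 - r) ^ 2 + dist s t ^ 2) ≤
      ‖(AddCircle.toCircle s : ℂ) - r * AddCircle.toCircle t‖ ^ 2 := by
    rw [h1]
    have h3 : (2 / π * dist s t) ^ 2 ≤
        ‖(AddCircle.toCircle s : ℂ) - AddCircle.toCircle t‖ ^ 2 := by gcongr
    have h4 : 2 / π ^ 2 ≤ 1 := by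
      rw [div_le_one (by positivity)]
      nlinarith [Real.pi_gt_three]
    have h5 : (2 / π * dist s t) ^ 2 = 2 * (2 / π ^ 2 * dist s t ^ 2) := by ring
    nlinarith [sq_nonneg (1 - r), hr.1, sq_nonneg (2 / π * dist s t)]
  rw [poissonKernel_def]
  simp only [sub_zero, norm_mul, Complex.norm_real, norm_of_nonneg hr0.le]
  rw [Circle.norm_coe, Circle.norm_coe]
  have hpos : 0 < (1 - r) ^ 2 + dist s t ^ 2 := by positivity
  rw [← mul_div_assoc, div_le_div_iff₀ (lt_of_lt_of_le (by positivity) h2) hpos]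
  have h6 : (1 - r) ^ 2 + dist s t ^ 2 ≤
      π ^ 2 / 2 * ‖(AddCircle.toCircle s : ℂ) - r * AddCircle.toCircle t‖ ^ 2 := by
    rw [← div_le_iff₀' (by positivity)]
    refine le_trans (le_of_eq ?_) h2
    field_simp
  have h7 : 1 ^ 2 - (r * 1) ^ 2 ≤ 2 * (1 - r) := by nlinarith
  calc _ ≤ 2 * (1 - r) * (π ^ 2 / 2 * _) := mul_le_mul h7 h6 hpos.le (by positivity)
    _ = _ := by ring

theorem poissonKernel_nonneg {r : ℝ} (hr : r ∈ Ioo (0 : ℝ) 1) (s t : AddCircle (2 * π)) :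
    0 ≤ poissonKernel 0 (r * (AddCircle.toCircle t : ℂ)) (AddCircle.toCircle s : ℂ) := by
  rw [poissonKernel_def]
  simp only [sub_zero, norm_mul, Complex.norm_real, norm_of_nonneg hr.1.le]
  rw [Circle.norm_coe, Circle.norm_coe]
  have := hr.1
  have := hr.2
  exact div_nonneg (by nlinarith) (by positivity)

theorem integral_poissonKernel {r : ℝ} (hr : r ∈ Ioo (0 : ℝ) 1) (t : AddCircle (2 * π)) :
    ∫ s, poissonKernel 0 (r * (AddCircle.toCircle t : ℂ)) (AddCircle.toCircle s : ℂ)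
      ∂circleMeasure = 1 := by
  have h := (diffContOnCl_const (c := (1 : ℂ))).circleAverage_poissonKernel_smul
    (mul_toCircle_mem_ball hr t)
  rw [circleAverage_eq_integral_circleMeasure] at h
  simp only [Pi.smul_apply', Complex.real_smul, mul_one, Complex.ofReal_one, one_mul] at h
  rw [integral_complex_ofReal] at h
  exact_mod_cast h

theorem continuous_poissonKernel_toCircle {r : ℝ} (hr : r ∈ Ioo (0 : ℝ) 1)
    (t : AddCircle (2 * π)) : Continuous fun s : AddCircle (2 * π) ↦
      poissonKernel 0 (r * (AddCircle.toCircle t : ℂ)) (AddCircle.toCircle s : ℂ) := by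
  have hc : Continuous fun s : AddCircle (2 * π) ↦ (AddCircle.toCircle s : ℂ) :=
    continuous_subtype_val.comp AddCircle.continuous_toCircle
  simp only [poissonKernel_def, sub_zero]
  refine ((hc.norm.pow 2).sub continuous_const).div ((hc.sub continuous_const).norm.pow 2)
    fun s h0 ↦ ?_
  have h1 := pow_eq_zero_iff two_ne_zero |>.1 h0
  rw [norm_eq_zero, sub_eq_zero] at h1
  have h2 := congrArg norm h1
  rw [norm_mul, Circle.norm_coe, Circle.norm_coe, Complex.norm_real, norm_of_nonneg hr.1.le] at h2
  linarith [hr.2]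

theorem integrable_poissonKernel_smul {F : Type*} [NormedAddCommGroup F] [NormedSpace ℝ F]
    {g : AddCircle (2 * π) → F} (hg : Integrable g circleMeasure) {r : ℝ} (hr : r ∈ Ioo (0 : ℝ) 1)
    (t : AddCircle (2 * π)) :
    Integrable (fun s ↦ poissonKernel 0 (r * (AddCircle.toCircle t : ℂ))
      (AddCircle.toCircle s : ℂ) • g s) circleMeasure := by
  have hc := continuous_poissonKernel_toCircle hr t
  obtain ⟨C, hC⟩ := isCompact_univ.exists_bound_of_continuousOn hc.continuousOn
  exact hg.bdd_smul C hc.aestronglyMeasurable (Eventually.of_forall fun s ↦ hC s (mem_univ s))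

/-- **Fatou's theorem** for Bochner integrable functions: the Poisson integral of `g` has radial
limit `g t` at every Lebesgue point `t` of `g`. -/
theorem ae_tendsto_integral_poissonKernel_smul {F : Type*} [NormedAddCommGroup F]
    [NormedSpace ℝ F] [CompleteSpace F] {g : AddCircle (2 * π) → F}
    (hg : Integrable g circleMeasure) :
    ∀ᵐ t ∂circleMeasure, Tendsto (fun r : ℝ ↦ ∫ s, poissonKernel 0
      (r * (AddCircle.toCircle t : ℂ)) (AddCircle.toCircle s : ℂ) • g s ∂circleMeasure)
      (𝓝[<] 1) (𝓝 (g t)) := by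
  have hv : (volume : Measure (AddCircle (2 * π))) = ENNReal.ofReal (2 * π) • circleMeasure :=
    AddCircle.volume_eq_smul_haarAddCircle
  have hgv : Integrable g volume := by
    rw [hv]; exact hg.smul_measure ENNReal.ofReal_ne_top
  have hleb := IsUnifLocDoublingMeasure.ae_tendsto_average_norm_sub volume
    hgv.locallyIntegrable 1
  rw [hv, Measure.ae_ennreal_smul_measure_eq (by simp [Real.pi_pos]), ← hv] at hleb
  filter_upwards [hleb] with t ht
  set φ : AddCircle (2 * π) → ℝ := fun s ↦ ‖g s - g t‖ with hφdef
  have hφ : Integrable φ volume := (hgv.sub (integrable_const _)).norm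
  have hφc : Integrable φ circleMeasure := (hg.sub (integrable_const _)).norm
  have hφ0 : 0 ≤ φ := fun s ↦ norm_nonneg _
  -- The Lebesgue point condition, with `volume (closedBall t ρ) ≤ 2 ρ`.
  have hball : ∀ ε > 0, ∃ η > 0, ∀ ρ ∈ Ioc 0 η, ∫ s in closedBall t ρ, φ s ≤ ε * ρ := by
    intro ε hε
    have h := ht (ι := ℝ) (l := 𝓝[>] 0) (fun _ ↦ t) id tendsto_id ?_
    · have h' := h.eventually (gt_mem_nhds (half_pos hε))
      obtain ⟨η, hη, hη'⟩ := mem_nhdsGT_iff_exists_Ioc_subset.1 h'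
      refine ⟨η, hη, fun ρ hρ ↦ ?_⟩
      have h1 : ⨍ s in closedBall t ρ, φ s < ε / 2 := hη' hρ
      have h2 : volume.real (closedBall t ρ) = min (2 * π) (2 * ρ) := by
        rw [Measure.real, AddCircle.volume_closedBall, ENNReal.toReal_ofReal]
        have := hρ.1
        positivity
      have h3 : 0 < min (2 * π) (2 * ρ) := lt_min Real.two_pi_pos (by linarith [hρ.1])
      rw [setAverage_eq, h2, smul_eq_mul, inv_mul_lt_iff₀ h3] at h1
      refine h1.le.trans ?_
      nlinarith [min_le_right (2 * π) (2 * ρ)]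
    · filter_upwards [self_mem_nhdsWithin] with ρ hρ
      exact mem_closedBall_self (by simpa using (mem_Ioi.1 hρ).le)
  have hmain : ∀ ε > 0, ∀ᶠ r : ℝ in 𝓝[<] (1 : ℝ), ‖(∫ s, poissonKernel 0
      (r * (AddCircle.toCircle t : ℂ)) (AddCircle.toCircle s : ℂ) • g s ∂circleMeasure) - g t‖
      ≤ π * ε := by
    intro ε hε
    obtain ⟨η, hη, hη'⟩ := hball (ε / 2) (by positivity)
    have hsmall : ∀ᶠ r in 𝓝[<] (1 : ℝ), (∫ s, φ s) * ((1 - r) / η ^ 2) < ε := by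
      have hc : Continuous fun r : ℝ ↦ (∫ s, φ s) * ((1 - r) / η ^ 2) := by fun_prop
      have := (hc.tendsto 1).mono_left (nhdsWithin_le_nhds (s := Iio (1 : ℝ)))
      exact this.eventually (gt_mem_nhds (by simpa using hε))
    filter_upwards [hsmall, Ico_mem_nhdsLT (show (1 / 2 : ℝ) < 1 by norm_num)] with r hr hr1
    have hr2 : r ∈ Ioo (0 : ℝ) 1 := ⟨by linarith [hr1.1], hr1.2⟩
    have hδ : 0 < 1 - r := by linarith [hr1.2]
    set P := fun s : AddCircle (2 * π) ↦
      poissonKernel 0 (r * (AddCircle.toCircle t : ℂ)) (AddCircle.toCircle s : ℂ)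
    have hdiff : (∫ s, P s • g s ∂circleMeasure) - g t =
        ∫ s, P s • (g s - g t) ∂circleMeasure := by
      simp_rw [smul_sub]
      rw [integral_sub (integrable_poissonKernel_smul hg hr2 t)
        (integrable_poissonKernel_smul (integrable_const _) hr2 t), integral_smul_const,
        integral_poissonKernel hr2 t, one_smul]
    have hcont : Continuous fun s ↦ (1 - r) / ((1 - r) ^ 2 + dist s t ^ 2) :=
      continuous_const.div (by fun_prop) fun y ↦ by positivity
    obtain ⟨B, hB⟩ := isCompact_univ.exists_bound_of_continuousOn hcont.continuousOn
    have hik : Integrable (fun s ↦ (1 - r) / ((1 - r) ^ 2 + dist s t ^ 2) * φ s) circleMeasure :=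
      hφc.bdd_mul hcont.aestronglyMeasurable (Eventually.of_forall fun s ↦ hB s (mem_univ s))
    rw [hdiff]
    calc ‖∫ s, P s • (g s - g t) ∂circleMeasure‖ ≤ ∫ s, P s * φ s ∂circleMeasure := by
          refine (norm_integral_le_integral_norm _).trans (le_of_eq (integral_congr_ae ?_))
          refine Eventually.of_forall fun s ↦ ?_
          simp only [norm_smul, norm_of_nonneg (poissonKernel_nonneg hr2 s t), P, φ]
      _ ≤ ∫ s, π ^ 2 * ((1 - r) / ((1 - r) ^ 2 + dist s t ^ 2) * φ s) ∂circleMeasure := by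
          refine integral_mono (integrable_poissonKernel_smul hφc hr2 t) (hik.const_mul _)
            fun s ↦ ?_
          simp only
          rw [← mul_assoc]
          exact mul_le_mul_of_nonneg_right (poissonKernel_toCircle_le hr1 s t) (hφ0 s)
      _ = π / 2 * ∫ s, (1 - r) / ((1 - r) ^ 2 + dist s t ^ 2) * φ s := by
          rw [integral_const_mul, AddCircle.integral_haarAddCircle, smul_eq_mul]
          field_simp
      _ ≤ π / 2 * (2 * (ε / 2) + (∫ s, φ s) * ((1 - r) / η ^ 2)) := by
          gcongr
          exact integral_cauchyKernel_mul_le hφ hφ0 t hδ (by positivity) hη hη'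
      _ ≤ π / 2 * (2 * (ε / 2) + ε) := by gcongr
      _ = π * ε := by ring
  rw [Metric.tendsto_nhds]
  intro ε hε
  filter_upwards [hmain (ε / (2 * π)) (by positivity)] with r hr
  rw [dist_eq_norm]
  refine hr.trans_lt ?_
  field_simp
  linarith

/-! ### Poisson integrals and Fourier coefficients -/

/-- The Poisson kernel is the sum of the geometric series of `w * conj z` and of its conjugate, the
latter without the constant term. -/
theorem hasSum_poissonKernel {w z : ℂ} (hw : ‖w‖ < 1) (hz : ‖z‖ = 1) :
    HasSum (fun n : ℕ ↦ (w * starRingEnd ℂ z) ^ n + (starRingEnd ℂ w * z) ^ (n + 1))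
      (poissonKernel 0 w z : ℂ) := by
  set q := w * starRingEnd ℂ z with hq
  have hq' : starRingEnd ℂ w * z = starRingEnd ℂ q := by simp [hq]
  have hzz : z * starRingEnd ℂ z = 1 := by
    rw [Complex.mul_conj, Complex.normSq_eq_norm_sq, hz]; simp
  have hqn : ‖q‖ < 1 := by simpa [hq, hz] using hw
  have hqn' : ‖starRingEnd ℂ q‖ < 1 := by simpa using hqn
  have h1 : 1 - q ≠ 0 := fun h ↦ by
    rw [← sub_eq_zero.1 h] at hqn; simp at hqn
  have h2 : 1 - starRingEnd ℂ q ≠ 0 := fun h ↦ by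
    rw [← sub_eq_zero.1 h] at hqn'; simp at hqn'
  rw [hq']
  have hs := (hasSum_geometric_of_norm_lt_one hqn).add
    ((hasSum_geometric_of_norm_lt_one hqn').mul_left (starRingEnd ℂ q))
  convert! hs using 1
  · ext n; rw [pow_succ']
  · have hn : z - w = z * (1 - q) := by
      rw [hq]; linear_combination w * hzz
    have hn2 : ‖z - w‖ = ‖1 - q‖ := by rw [hn, norm_mul, hz, one_mul]
    have hw2 : ‖w‖ = ‖q‖ := by simp [hq, hz]
    rw [poissonKernel_def]
    simp only [sub_zero]
    rw [hn2, hw2, hz]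
    push_cast
    rw [← Complex.mul_conj', ← Complex.mul_conj', map_sub, map_one]
    field_simp
    ring

theorem MeasureTheory.Integrable.hasSum_poissonKernel_smul {E : Type*} [NormedAddCommGroup E]
    [NormedSpace ℂ E] [CompleteSpace E] {g : AddCircle (2 * π) → E} (hg : Integrable g circleMeasure)
    {r : ℝ} (hr : r ∈ Ioo (0 : ℝ) 1) (t : AddCircle (2 * π)) :
    HasSum (fun n : ℕ ↦ (r * (AddCircle.toCircle t : ℂ)) ^ n • fourierCoeff g n +
        (starRingEnd ℂ (r * (AddCircle.toCircle t : ℂ))) ^ (n + 1) •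
          fourierCoeff g (-((n + 1 : ℕ) : ℤ)))
      (∫ s, poissonKernel 0 (r * (AddCircle.toCircle t : ℂ)) (AddCircle.toCircle s : ℂ) • g s
        ∂circleMeasure) := by
  set w : ℂ := r * (AddCircle.toCircle t : ℂ) with hw
  have hwn : ‖w‖ = r := by rw [hw, norm_mul, Circle.norm_coe]; simp [abs_of_pos hr.1]
  clear_value w
  set F : ℕ → AddCircle (2 * π) → E := fun n s ↦
    w ^ n • fourier (-(n : ℤ)) s • g s +
      (starRingEnd ℂ w) ^ (n + 1) • fourier (-(-((n + 1 : ℕ) : ℤ))) s • g s with hF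
  have hF1 (n : ℕ) : Integrable (fun s ↦ w ^ n • fourier (-(n : ℤ)) s • g s) circleMeasure :=
    (hg.fourier_smul _).smul _
  have hF2 (n : ℕ) : Integrable (fun s ↦ (starRingEnd ℂ w) ^ (n + 1) •
      fourier (-(-((n + 1 : ℕ) : ℤ))) s • g s) circleMeasure := (hg.fourier_smul _).smul _
  have hFi (n : ℕ) : Integrable (F n) circleMeasure := (hF1 n).add (hF2 n)
  have hfn (n : ℤ) (s : AddCircle (2 * π)) : ‖fourier n s‖ = 1 := Circle.norm_coe _
  have hbound (n : ℕ) (s) : ‖F n s‖ ≤ r ^ n * (2 * ‖g s‖) := by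
    refine (norm_add_le _ _).trans ?_
    rw [norm_smul, norm_smul, norm_smul, norm_smul, hfn, hfn, norm_pow, norm_pow,
      RCLike.norm_conj, hwn, pow_succ]
    have h1 : 0 ≤ r ^ n * ‖g s‖ := mul_nonneg (pow_nonneg hr.1.le n) (norm_nonneg _)
    nlinarith [hr.2]
  have hsum : Summable fun n ↦ ∫ s, ‖F n s‖ ∂circleMeasure := by
    refine ((summable_geometric_of_lt_one hr.1.le hr.2).mul_right
      (∫ s, 2 * ‖g s‖ ∂circleMeasure)).of_nonneg_of_le
      (fun n ↦ integral_nonneg fun s ↦ norm_nonneg _) fun n ↦ ?_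
    rw [← integral_const_mul]
    exact integral_mono (hFi n).norm ((hg.norm.const_mul 2).const_mul _) (hbound n)
  have key := hasSum_integral_of_summable_integral_norm hFi hsum
  convert! key using 1
  · ext n
    simp only [hF]
    rw [integral_add (hF1 n) (hF2 n), integral_smul, integral_smul]
    · rfl
    all_goals exact hg.fourier_smul _
  · refine integral_congr_ae (Eventually.of_forall fun s ↦ ?_)
    have h := (hasSum_poissonKernel (w := w) (z := AddCircle.toCircle s) (hwn.trans_lt hr.2)
      (Circle.norm_coe _)).smul_const (g s)
    rw [Complex.coe_smul] at h
    refine h.tsum_eq.symm.trans (tsum_congr fun n ↦ ?_)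
    simp only [hF]
    rw [add_smul, mul_pow, mul_pow, mul_smul, mul_smul, fourier_neg, neg_neg, fourier_apply,
      fourier_apply, natCast_zsmul, natCast_zsmul, AddCircle.toCircle_nsmul,
      AddCircle.toCircle_nsmul, Circle.coe_pow, Circle.coe_pow, map_pow]

/-- If the Fourier coefficients of `g` of negative index vanish, then the Poisson integral of `g` is
the power series with coefficients `fourierCoeff g n`, so this power series has boundary values
`g`. -/
theorem ae_hasRadialLimit_of_fourierCoeff {E : Type*} [NormedAddCommGroup E] [NormedSpace ℂ E]
    [CompleteSpace E] {g : AddCircle (2 * π) → E} (hg : Integrable g circleMeasure)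
    (hneg : ∀ n : ℤ, n < 0 → fourierCoeff g n = 0) {f : ℂ → E}
    (hf : ∀ z ∈ ball (0 : ℂ) 1, HasSum (fun n : ℕ ↦ z ^ n • fourierCoeff g n) (f z)) :
    ∀ᵐ t ∂circleMeasure, HasRadialLimit f t (g t) := by
  filter_upwards [ae_tendsto_integral_poissonKernel_smul hg] with t ht
  refine ht.congr' ?_
  filter_upwards [Ioo_mem_nhdsLT (show (0 : ℝ) < 1 by norm_num)] with r hr
  refine (hg.hasSum_poissonKernel_smul hr t).unique ?_
  convert! hf _ (mul_toCircle_mem_ball hr t) using 1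
  ext n
  rw [hneg (-((n + 1 : ℕ) : ℤ)) (by omega), smul_zero, add_zero]

/-! ### Fourier coefficients in `L²_E` -/

section FourierLp

variable {E : Type*} [NormedAddCommGroup E] [InnerProductSpace ℂ E]

variable (E) in
/-- The map sending a vector `v` to the class of `t ↦ exp (i n t) • v` in `L²_E` of the circle. It
is isometric, and the ranges for different `n` are orthogonal. -/
noncomputable def fourierLpVec (n : ℤ) : E →ₗ[ℂ] Lp E 2 circleMeasure where
  toFun v := ContinuousMap.toLp 2 circleMeasure ℂ
    (⟨fun t ↦ fourier n t • v, by fun_prop⟩ : C(AddCircle (2 * π), E))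
  map_add' u v := by
    rw [← map_add]
    congr 1
    ext t
    simp
  map_smul' c v := by
    rw [RingHom.id_apply, ← map_smul]
    congr 1
    ext t
    exact smul_comm _ _ _

theorem coeFn_fourierLpVec (n : ℤ) (v : E) :
    fourierLpVec E n v =ᵐ[circleMeasure] fun t ↦ fourier n t • v :=
  ContinuousMap.coeFn_toLp circleMeasure _

theorem integrable_of_Lp_two {F : Type*} [NormedAddCommGroup F] (g : Lp F 2 circleMeasure) :
    Integrable g circleMeasure :=
  (Lp.memLp g).integrable one_le_two

theorem inner_fourierLpVec [CompleteSpace E] (n : ℤ) (v : E) (g : Lp E 2 circleMeasure) :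
    inner ℂ (fourierLpVec E n v) g = inner ℂ v (fourierCoeff g n) := by
  rw [L2.inner_def, fourierCoeff, ← integral_inner ((integrable_of_Lp_two g).fourier_smul _)]
  refine integral_congr_ae ?_
  filter_upwards [coeFn_fourierLpVec n v] with t ht
  rw [ht, inner_smul_left, inner_smul_right, fourier_neg]

theorem fourierCoeff_fourierLpVec (m n : ℤ) (v : E) [CompleteSpace E] :
    fourierCoeff (T := 2 * π) (fourierLpVec E m v) n = if n = m then v else 0 := by
  rw [fourierCoeff_congr_ae (T := 2 * π) (coeFn_fourierLpVec m v)]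
  have h : fourierCoeff (fun t : AddCircle (2 * π) ↦ fourier m t • v) n =
      fourierCoeff (fourier m : AddCircle (2 * π) → ℂ) n • v := by
    simp only [fourierCoeff]
    rw [← integral_smul_const]
    simp only [smul_smul, smul_eq_mul]
  rw [h, fourierCoeff_fourier, Pi.single_apply]
  split_ifs <;> simp

theorem inner_fourierLpVec_fourierLpVec [CompleteSpace E] (m n : ℤ) (u v : E) :
    inner ℂ (fourierLpVec E n u) (fourierLpVec E m v) = if n = m then inner ℂ u v else 0 := by
  rw [inner_fourierLpVec, fourierCoeff_fourierLpVec]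
  split_ifs <;> simp

variable (E) in
theorem orthogonalFamily_fourierLpVec [CompleteSpace E] :
    OrthogonalFamily ℂ (fun _ : ℤ ↦ E) fun n ↦ (fourierLpVec E n).isometryOfInner
      fun u v ↦ by rw [inner_fourierLpVec_fourierLpVec, if_pos rfl] := by
  intro m n hmn u v
  simp only [LinearMap.coe_isometryOfInner]
  rw [inner_fourierLpVec_fourierLpVec, if_neg hmn]

/-- **Riesz–Fischer theorem**: a square summable family of vectors is the family of Fourier
coefficients of an `L²` function. -/
theorem exists_Lp_fourierCoeff_eq [CompleteSpace E] {a : ℤ → E} (ha : Summable fun n ↦ ‖a n‖ ^ 2) :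
    ∃ g : Lp E 2 circleMeasure, ∀ n, fourierCoeff g n = a n := by
  have hs := ((orthogonalFamily_fourierLpVec E).summable_iff_norm_sq_summable a).2 ha
  simp only [LinearMap.coe_isometryOfInner] at hs
  refine ⟨∑' n, fourierLpVec E n (a n), fun n ↦ ext_inner_left ℂ fun v ↦ ?_⟩
  rw [← inner_fourierLpVec]
  have h := (innerSL ℂ (fourierLpVec E n v)).hasSum hs.hasSum
  refine h.unique ?_
  simp only [innerSL_apply_apply, inner_fourierLpVec_fourierLpVec]
  convert! hasSum_ite_eq n (inner ℂ v (a n)) using 2 with k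
  by_cases hk : n = k
  · simp [hk]
  · simp [hk, Ne.symm hk]

/-- The Fourier coefficients of a vector-valued `L²` function are square summable (Bessel). -/
theorem summable_norm_sq_fourierCoeff [CompleteSpace E] (g : Lp E 2 circleMeasure) :
    Summable fun n ↦ ‖fourierCoeff g n‖ ^ 2 := by
  refine summable_of_sum_le (c := ‖g‖ ^ 2) (fun n ↦ by positivity) fun s ↦ ?_
  have h1 := (orthogonalFamily_fourierLpVec E).norm_sum (fun n ↦ fourierCoeff g n) s
  simp only [LinearMap.coe_isometryOfInner] at h1
  set h := ∑ n ∈ s, fourierLpVec E n (fourierCoeff g n)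
  have h2 : inner ℂ h g = ((∑ n ∈ s, ‖fourierCoeff g n‖ ^ 2 : ℝ) : ℂ) := by
    simp only [h, sum_inner, inner_fourierLpVec, inner_self_eq_norm_sq_to_K]
    push_cast
    rfl
  have h3 : ‖h‖ ^ 2 ≤ ‖h‖ * ‖g‖ := by
    have := norm_inner_le_norm (𝕜 := ℂ) h g
    rw [h2, ← h1, Complex.norm_real, norm_of_nonneg (by positivity)] at this
    exact this
  rw [← h1]
  nlinarith [norm_nonneg h, norm_nonneg g, sq_nonneg (‖h‖ - ‖g‖)]

end FourierLp

/-! ### The two forms of the Hardy space -/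

theorem hasSum_pow_smul_of_summable_sq {E : Type*} [NormedAddCommGroup E] [NormedSpace ℂ E]
    [CompleteSpace E] {a : ℕ → E} (ha : Summable fun n ↦ ‖a n‖ ^ 2) {z : ℂ}
    (hz : z ∈ ball (0 : ℂ) 1) : HasSum (fun n ↦ z ^ n • a n) (∑' n, z ^ n • a n) := by
  refine (Summable.of_norm ?_).hasSum
  rw [mem_ball_zero_iff] at hz
  simpa only [norm_smul, norm_pow] using
    summable_pow_mul_of_summable_sq ha ⟨norm_nonneg z, hz⟩ fun n ↦ norm_nonneg _

theorem MemHardyDisc.ae_exists_hasRadialLimit {E : Type*} [NormedAddCommGroup E]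
    [InnerProductSpace ℂ E] [CompleteSpace E] {f : ℂ → E} (hf : MemHardyDisc f) :
    ∀ᵐ t ∂circleMeasure, ∃ w : E, HasRadialLimit f t w := by
  obtain ⟨a, ha, hfa⟩ := hf
  set b : ℤ → E := fun n ↦ if 0 ≤ n then a n.toNat else 0 with hb
  have hbn (n : ℕ) : b n = a n := by simp [hb]
  have hbs : Summable fun n ↦ ‖b n‖ ^ 2 := by
    refine (Nat.cast_injective.summable_iff fun n hn ↦ ?_).1 (by simpa [Function.comp_def, hbn])
    have : ¬ 0 ≤ n := fun h ↦ hn ⟨n.toNat, Int.toNat_of_nonneg h⟩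
    simp [hb, this]
  obtain ⟨g, hg⟩ := exists_Lp_fourierCoeff_eq hbs
  have h := ae_hasRadialLimit_of_fourierCoeff (integrable_of_Lp_two g) (f := f)
    (fun n hn ↦ by rw [hg]; exact if_neg hn.not_ge)
    fun z hz ↦ by simpa only [hg, hbn] using hfa z hz
  exact h.mono fun t ht ↦ ⟨_, ht⟩

/-- The power series `f` with coefficients `fourierCoeff g n` has radial limit `g t` at almost every
`t`. Hence `f ≠ 0` since `g ≠ 0`, and up to a null set `g` vanishes only where `f` has radial
limit `0`. -/
theorem MemHardyCircle.measure_zero_set {E : Type*} [NormedAddCommGroup E]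
    [InnerProductSpace ℂ E] [CompleteSpace E] {g : Lp E 2 circleMeasure} (hg : MemHardyCircle g)
    (hne : g ≠ 0) : circleMeasure {t | g t = 0} = 0 := by
  have hs : Summable fun n : ℕ ↦ ‖fourierCoeff g n‖ ^ 2 :=
    (summable_norm_sq_fourierCoeff g).comp_injective Nat.cast_injective
  set f : ℂ → E := fun z ↦ ∑' n : ℕ, z ^ n • fourierCoeff g n
  have hf : ∀ z ∈ ball (0 : ℂ) 1, HasSum (fun n : ℕ ↦ z ^ n • fourierCoeff g n) (f z) :=
    fun z hz ↦ hasSum_pow_smul_of_summable_sq hs hz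
  have hlim := ae_hasRadialLimit_of_fourierCoeff (integrable_of_Lp_two g) hg hf
  have hfne : ∃ z ∈ ball (0 : ℂ) 1, f z ≠ 0 := by
    by_contra! h0
    refine hne ((Lp.eq_zero_iff_ae_eq_zero).2 ?_)
    filter_upwards [hlim] with t ht
    refine tendsto_nhds_unique (ht.congr' ?_) tendsto_const_nhds
    filter_upwards [Ioo_mem_nhdsLT (show (0 : ℝ) < 1 by norm_num)] with r hr
    exact h0 _ (mul_toCircle_mem_ball hr t)
  have hzero := MemHardyDisc.measure_radialLimit_zero ⟨_, hs, hf⟩ hfne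
  refine measure_mono_null (fun t ht ↦ ?_) (measure_union_null hzero (ae_iff.1 hlim))
  by_cases h : HasRadialLimit f t (g t)
  · left
    rwa [show g t = 0 from ht] at h
  · exact Or.inr h

theorem lemma4p3 {E : Type*} [NormedAddCommGroup E] [InnerProductSpace ℂ E] [CompleteSpace E]
    [TopologicalSpace.SeparableSpace E] :
    (∀ f : ℂ → E, MemHardyDisc f → (∃ z ∈ Metric.ball (0 : ℂ) 1, f z ≠ 0) →
      (∀ᵐ t ∂circleMeasure, ∃ w : E, HasRadialLimit f t w) ∧
      circleMeasure {t | HasRadialLimit f t 0} = 0) ∧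
    (∀ g : MeasureTheory.Lp E 2 circleMeasure, MemHardyCircle g → g ≠ 0 →
      circleMeasure {t | g t = 0} = 0) :=
  ⟨fun _ hf hne ↦ ⟨hf.ae_exists_hasRadialLimit, hf.measure_radialLimit_zero hne⟩,
    fun _ hg hne ↦ hg.measure_zero_set hne⟩
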